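/- A *partial automaton* has a set $Q$ of states, an alphabet $\Sigma$ of letters, and edges $q \overset{a}{\to} r$ ($q, r \in Q$, $a \in \Sigma$), with at most one edge labelled $a$ leaving each state $q$. Its *automatic algebra* is the set $Q \cup \Sigma \cup \{0\}$ (with $Q$, $\Sigma$, $\{0\}$ pairwise disjoint) with the binary operation given by $q \cdot a = r$ if $q \overset{a}{\to} r$, all other products being $0$. For $a \in \Sigma$ put $\operatorname{dom} a = \{q \in Q \mid qa \neq 0\}$, $\operatorname{ran} a = \{qa \mid q \in \operatorname{dom} a\}$, and $\operatorname{ks} a = Q \setminus \operatorname{dom} a$ (the *kill states* of $a$). For $q \in Q$ and a word $w = a_1 a_2 \dots a_n \in \Sigma^*$ ($n \ge 0$), write $qw = (\cdots((q \cdot a_1) \cdot a_2) \cdots) \cdot a_n$. A finite algebra $\mathbf{N}$ is *dualizable* if it has an alter ego that yields a duality on $\mathbb{ISP}(\mathbf{N})$. That is, there are a set of finitary total operations, a set of finitary partial operations and a set of finitary relations on $N$, all compatible with $\mathbf{N}$ (homomorphisms $\mathbf{N}^n \to \mathbf{N}$, homomorphisms into $\mathbf{N}$ from subalgebras of $\mathbf{N}^n$,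 and subuniverses of $\mathbf{N}^n$, respectively), such that for every $\mathbf{A} \in \mathbb{ISP}(\mathbf{N})$ (non-empty algebras isomorphic to a subalgebra of a power of $\mathbf{N}$), every map $\operatorname{hom}(\mathbf{A}, \mathbf{N}) \to N$ that is continuous (where $N$ is discrete and $\operatorname{hom}(\mathbf{A}, \mathbf{N}) \subseteq N^A$ has the subspace topology of the product) and preserves these operations, partial operations and relations, taken pointwise on $\operatorname{hom}(\mathbf{A}, \mathbf{N})$, is evaluation $x \mapsto x(c)$ at a unique $c \in A$. A finite algebra $\mathbf{M}$ is *inherently non-dualizable* if every finite algebra that has $\mathbf{M}$ as a subalgebra is not dualizable. **Corollary 2.7.** A finite automatic algebra $\mathbf{M} = \langle Q \cup \Sigma \cup \{0\}; \cdot \rangle$ is inherently non-dualizable if there exists $a \in \Sigma$ such that one of the following conditions holds: 1. there is a path from the kill states of $a$ to the domain of $a$, that is, there are $q \in \operatorname{ks} a$ and $w \in \Sigma^*$ such that $qw \in \operatorname{dom} a$; 2. there is a path from the range of $a$ to the kill states of $a$, that is, there are $q \in \operatorname{ran} a$ and $w \in \Sigma^*$ such that $qw \in \operatorname{ks} a$.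 -/

import Mathlib

universe u v

/-- Underlying set `Q ∪ Σ ∪ {0}` (a disjoint union) of the automatic algebra that encodes the
partial automaton with state set `Q`, alphabet `S` and edges `q →[a] r` iff `δ q a = some r`. -/
inductive AutomaticAlgebra {Q : Type u} {S : Type v} (δ : Q → S → Option Q) : Type (max u v)
  | state (q : Q)
  | letter (a : S)
  | zero

namespace AutomaticAlgebra

variable {Q : Type u} {S : Type v} {δ : Q → S → Option Q}

instance : Zero (AutomaticAlgebra δ) := ⟨zero⟩

/-- `q · a = r` iff `q →[a] r`; all other products are `0`. -/
instance : Mul (AutomaticAlgebra δ) where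
  mul
    | state q, letter a =>
      match δ q a with
      | some r => state r
      | none => zero
    | _, _ => zero

/-- The set of states, as a subset of the algebra. -/
def states (δ : Q → S → Option Q) : Set (AutomaticAlgebra δ) := Set.range state

/-- `dom a = {q ∈ Q | q a ≠ 0}`. -/
def dom (δ : Q → S → Option Q) (a : S) : Set (AutomaticAlgebra δ) :=
  {u | u ∈ states δ ∧ u * letter a ≠ 0}

/-- `ran a = {q a | q ∈ dom a}`. -/
def ran (δ : Q → S → Option Q) (a : S) : Set (AutomaticAlgebra δ) :=
  (fun u => u * letter a) '' dom δ a

/-- The kill states of `a`: `Q \ dom a`. -/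
def killStates (δ : Q → S → Option Q) (a : S) : Set (AutomaticAlgebra δ) :=
  states δ \ dom δ a

/-- `u w = (⋯((u · a₁) · a₂) ⋯) · aₙ` for a word `w = a₁ a₂ ⋯ aₙ`, possibly empty. -/
def mulWord (u : AutomaticAlgebra δ) (w : List S) : AutomaticAlgebra δ :=
  w.foldl (fun x b => x * letter b) u

end AutomaticAlgebra

/-- `A ∈ ISP(M)`: `A` is isomorphic to a subalgebra of a power of `M`. -/
def MemISP (M : Type u) [Mul M] (A : Type u) [Mul A] : Prop :=
  ∃ (I : Type u) (e : A →ₙ* (I → M)), Function.Injective e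

/-- An alter ego of the algebra `M` (with one binary operation): the set `M` with the discrete
topology, a set of total operations, a set of partial operations and a set of relations, all
finitary and compatible with `M`. Here `Subsemigroup` is Mathlib's name for a subset
closed under the multiplication; no associativity is involved. -/
structure AlterEgo (M : Type u) [Mul M] where
  /-- homomorphisms `Mⁿ → M` -/
  ops : ∀ n : ℕ, Set ((Fin n → M) →ₙ* M)
  /-- homomorphisms into `M` from a subuniverse of `Mⁿ` -/
  partialOps : ∀ n : ℕ, Set (Σ D : Subsemigroup (Fin n → M), D →ₙ* M)
  /-- subuniverses of `Mⁿ` -/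
  rels : ∀ n : ℕ, Set (Subsemigroup (Fin n → M))

/-- The topology on the dual `hom(A, M)`, as a subspace of the power `M ^ A` of the
discrete space `M`. -/
abbrev dualTopology (M : Type u) [Mul M] (A : Type u) [Mul A] : TopologicalSpace (A →ₙ* M) :=
  TopologicalSpace.induced (fun x : A →ₙ* M => (x : A → M))
    (@Pi.topologicalSpace A (fun _ => M) (fun _ => ⊥))

/-- `α : hom(A, M) → M` is a morphism from the dual of `A` to the alter ego: it is continuous and
preserves the operations, partial operations and relations, which act
pointwise on `hom(A, M) ⊆ M ^ A`. -/
structure AlterEgo.IsMorphism {M : Type u} [Mul M] (E : AlterEgo M) {A : Type u} [Mul A]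
    (α : (A →ₙ* M) → M) : Prop where
  continuous : @Continuous _ _ (dualTopology M A) ⊥ α
  map_op : ∀ (n : ℕ), ∀ g ∈ E.ops n, ∀ x : Fin n → (A →ₙ* M),
    α (g.comp (MulHom.pi x)) = g (fun i => α (x i))
  map_partialOp : ∀ (n : ℕ), ∀ h ∈ E.partialOps n, ∀ (x : Fin n → (A →ₙ* M))
    (hx : ∀ c : A, MulHom.pi x c ∈ h.1),
    ∃ hα : (fun i => α (x i)) ∈ h.1,
      α (h.2.comp ((MulHom.pi x).codRestrict h.1 hx)) = h.2 ⟨fun i => α (x i), hα⟩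
  map_rel : ∀ (n : ℕ), ∀ r ∈ E.rels n, ∀ x : Fin n → (A →ₙ* M),
    (∀ c : A, (fun i => x i c) ∈ r) → (fun i => α (x i)) ∈ r

/-- `M` is dualizable: some alter ego of `M` yields a duality on `ISP(M)`, that is, for every
(non-empty) `A ∈ ISP(M)` the natural map from `A` to the morphisms `hom(A, M) → M`, sending
an element to evaluation at it, is bijective. -/
def IsDualizable (M : Type u) [Mul M] : Prop :=
  ∃ E : AlterEgo M, ∀ (A : Type u) [Mul A] [Nonempty A], MemISP M A →
    ∀ α : (A →ₙ* M) → M, E.IsMorphism α → ∃! c : A, ∀ x : A →ₙ* M, α x = x c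

/-- Every finite algebra that has (a copy of) `M` as a subalgebra is non-dualizable. -/
def InherentlyNonDualizable (M : Type u) [Mul M] : Prop :=
  ∀ (N : Type u) [Mul N] [Finite N] (e : M →ₙ* N), Function.Injective e → ¬ IsDualizable N

/-! Non-dualizability is shown by ghosts. If every homomorphism `h : A → N` takes one value along a
sequence `v` in `A`, up to a bounded number of exceptions, then sending `h` to that value is a
morphism for every alter ego. If no element of `A` realizes all these values, there is no duality.
Two constructions in powers of the automatic algebra supply ghosts: `not_isDualizable_of_mixture`
and `not_isDualizable_of_rel`.

Now let the algebra embed in a dualizable one. The relation construction forces each state in `ran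
a` onto an `a`-cycle. Suppose `p ∈ ran a`, `p w ≠ 0` and `p w a = 0`. Induction on the length of `w`
shows that no power of `w` kills `p`. Some power `w^m` acts idempotently at `p`, and `a^|w^m|` fixes
`p`; so `a^|w^m| w^m` and `w^m w^m` agree at `p`, while a mixture of them starts with `w a` and
kills `p`. This excludes condition 2.

If `q a = 0` but `q b a ≠ 0`, the exclusion of condition 2 yields a state that one of the letters
`a`, `b` sends to a state surviving all words in `a` and `b`, while the other letter leads to zero;
the relation construction forbids this. Following a path edge by edge excludes condition 1. -/

/-! ### The ghost element method -/

/-- Ghost element method: if the values of each homomorphism `h : A → N` along `v` are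
concentrated, up to boundedly many exceptions, on one value, and no element of `A` realizes
this value for all `h` at once, then `N` is not dualizable. -/
theorem not_isDualizable_of_ghost {N : Type u} [Mul N] [Finite N] {A : Type u} [Mul A]
    (hA : MemISP N A) (v : ℕ → A) (b : ℕ)
    (hv : ∀ (h : A →ₙ* N) (x y : N) (f g : Fin b ↪ ℕ), (∀ s, h (v (f s)) = x) →
      (∀ s, h (v (g s)) = y) → x = y)
    (hghost : ∀ c : A, ∃ h : A →ₙ* N, {k | h (v k) = h c}.Finite) :
    ¬ IsDualizable N := by
  rintro ⟨E, hE⟩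
  have hinf : ∀ h : A →ₙ* N, ∃ x, {k | h (v k) = x}.Infinite := fun h => by
    obtain ⟨x, hx⟩ := Finite.exists_infinite_fiber (fun k => h (v k))
    exact ⟨x, Set.infinite_coe_iff.1 hx⟩
  -- The ghost: a value taken infinitely often; `key` makes it the only value taken `b` times.
  choose α hα using hinf
  have emb : ∀ s : Set ℕ, s.Infinite → ∃ f : Fin b ↪ ℕ, ∀ i, f i ∈ s := fun s hs => by
    obtain ⟨t, hts, htb⟩ := hs.exists_subset_card_eq b
    exact ⟨⟨fun i => (t.equivFinOfCardEq htb).symm i, fun i j hij => by simpa using hij⟩,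
      fun i => hts ((t.equivFinOfCardEq htb).symm i).2⟩
  have key : ∀ (h : A →ₙ* N) (x : N) (f : Fin b ↪ ℕ), (∀ s, h (v (f s)) = x) → α h = x := by
    intro h x f hf
    obtain ⟨g, hg⟩ := emb _ (hα h)
    exact hv h _ _ g f hg hf
  have ev : ∀ h : A →ₙ* N, ∀ᶠ k in Filter.cofinite, h (v k) = α h := by
    intro h
    have : {k | ¬ h (v k) = α h} ⊆ ⋃ x ∈ {x | x ≠ α h}, {k | h (v k) = x} := by
      intro k hk
      simpa using hk
    refine Set.Finite.subset (Set.Finite.biUnion (Set.toFinite _) fun x hx => ?_) this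
    by_contra hi
    obtain ⟨f, hf⟩ := emb _ hi
    exact hx (key h x f hf).symm
  have hmor : E.IsMorphism α := by
    refine ⟨?_, ?_, ?_, ?_⟩
    · let _ : TopologicalSpace N := ⊥
      have : DiscreteTopology N := ⟨rfl⟩
      have : Fintype N := Fintype.ofFinite N
      classical
      let _ : TopologicalSpace (A →ₙ* N) := dualTopology N A
      -- Among this many indices some value occurs more than `b` times, so finitely many coordinates
      -- determine `α h`.
      set B := Fintype.card N * b + 1 with hB
      let ρ : (A →ₙ* N) → (Fin B → N) := fun h k => h (v k)
      have hρ : Continuous ρ := by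
        refine continuous_pi fun k => ?_
        exact (continuous_apply (v k)).comp continuous_induced_dom
      have hfac : ∀ h h', ρ h = ρ h' → α h = α h' := by
        intro h h' hh
        obtain ⟨x, hx⟩ := Fintype.exists_lt_card_fiber_of_mul_lt_card (ρ h) (n := b) (by simp [hB])
        obtain ⟨t, hts, htb⟩ := Finset.exists_subset_card_eq hx.le
        let f : Fin b ↪ ℕ := ⟨fun i => ((t.equivFinOfCardEq htb).symm i : Fin B), fun i j hij => by
          simpa [Fin.val_inj] using hij⟩
        have hf : ∀ s, ρ h ((t.equivFinOfCardEq htb).symm s) = x := fun s => by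
          have := hts ((t.equivFinOfCardEq htb).symm s).2
          simpa using this
        rw [key h x f hf, key h' x f fun s => by rw [← hf s, hh]; rfl]
      refine ⟨fun s _ => ?_⟩
      have : α ⁻¹' s = ρ ⁻¹' (ρ '' (α ⁻¹' s)) := by
        refine (Set.subset_preimage_image _ _).antisymm ?_
        rintro h ⟨h', hs, hh⟩
        rwa [Set.mem_preimage, ← hfac h' h hh]
      rw [this]
      exact (isOpen_discrete _).preimage hρ
    -- Finitely many homomorphisms agree with `α` at a common `v k`, and evaluation at `v k`
    -- preserves all compatible structure.
    · intro n g _ x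
      obtain ⟨k, hk, hk'⟩ := ((ev (g.comp (MulHom.pi x))).and
        (Filter.eventually_all.2 fun i => ev (x i))).exists
      rw [← hk, ← funext hk']
      rfl
    · intro n g _ x hx
      have hmem : (fun i => α (x i)) ∈ g.1 := by
        obtain ⟨k, hk⟩ := (Filter.eventually_all.2 fun i => ev (x i)).exists
        rw [← funext hk]
        exact hx (v k)
      refine ⟨hmem, ?_⟩
      obtain ⟨k, hk, hk'⟩ := ((ev (g.2.comp ((MulHom.pi x).codRestrict g.1 hx))).and
        (Filter.eventually_all.2 fun i => ev (x i))).exists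
      rw [← hk]
      change g.2 _ = g.2 _
      congr 1
      exact Subtype.ext (funext hk')
    · intro n r _ x hx
      obtain ⟨k, hk⟩ := (Filter.eventually_all.2 fun i => ev (x i)).exists
      rw [← funext hk]
      exact hx (v k)
  have : Nonempty A := ⟨v 0⟩
  obtain ⟨c, hc, -⟩ := hE A hA α hmor
  obtain ⟨h, hh⟩ := hghost c
  exact hα h (by simpa [hc h] using hh)

/-! ### Products and words in automatic algebras -/

namespace AutomaticAlgebra

variable {Q : Type u} {S : Type v} {δ : Q → S → Option Q}

/-- The elements that are states or zero. -/
def nonletters (δ : Q → S → Option Q) : Set (AutomaticAlgebra δ) := {x | ∀ a, x ≠ letter a}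

theorem mul_eq_zero_of_left {x : AutomaticAlgebra δ} (hx : x ∉ states δ)
    (y : AutomaticAlgebra δ) : x * y = 0 := by
  cases x with
  | state q => exact absurd ⟨q, rfl⟩ hx
  | letter a => rfl
  | zero => rfl

theorem mul_eq_zero_of_right (x : AutomaticAlgebra δ) {y : AutomaticAlgebra δ}
    (hy : y ∈ nonletters δ) : x * y = 0 := by
  cases y with
  | state q => cases x <;> rfl
  | letter a => exact absurd rfl (hy a)
  | zero => cases x <;> rfl

theorem zero_mem_nonletters : (0 : AutomaticAlgebra δ) ∈ nonletters δ := fun _ h => by cases h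

theorem zero_notMem_states : (0 : AutomaticAlgebra δ) ∉ states δ := by
  rintro ⟨q, h⟩
  cases h

theorem letter_notMem_states (a : S) : (letter a : AutomaticAlgebra δ) ∉ states δ := by
  rintro ⟨q, h⟩
  cases h

theorem letter_ne_zero (a : S) : (letter a : AutomaticAlgebra δ) ≠ 0 := fun h => by cases h

protected theorem zero_mul (x : AutomaticAlgebra δ) : 0 * x = 0 :=
  mul_eq_zero_of_left zero_notMem_states x

protected theorem mul_zero (x : AutomaticAlgebra δ) : x * 0 = 0 :=
  mul_eq_zero_of_right x zero_mem_nonletters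

theorem mem_states_iff {x : AutomaticAlgebra δ} : x ∈ states δ ↔ x ∈ nonletters δ ∧ x ≠ 0 := by
  cases x with
  | state q => exact ⟨fun _ => ⟨fun _ => nofun, nofun⟩, fun _ => ⟨q, rfl⟩⟩
  | letter a => exact ⟨fun h => absurd h (letter_notMem_states a), fun h => absurd rfl (h.1 a)⟩
  | zero => exact ⟨fun h => absurd h zero_notMem_states, fun h => absurd rfl h.2⟩

theorem mul_mem_nonletters (x y : AutomaticAlgebra δ) : x * y ∈ nonletters δ := by
  intro a h
  rcases x with q | b | _
  · rcases y with r | b | _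
    · cases h
    · change (match δ q b with | some r => state r | none => zero) = letter a at h
      split at h <;> cases h
    · cases h
  · cases h
  · cases h

theorem mulWord_append (x : AutomaticAlgebra δ) (w t : List S) :
    mulWord x (w ++ t) = mulWord (mulWord x w) t := List.foldl_append

@[simp]
theorem mulWord_nil (x : AutomaticAlgebra δ) : mulWord x [] = x := rfl

@[simp]
theorem mulWord_cons (x : AutomaticAlgebra δ) (a : S) (w : List S) :
    mulWord x (a :: w) = mulWord (x * letter a) w := rfl

theorem mulWord_zero (w : List S) : mulWord (0 : AutomaticAlgebra δ) w = 0 := by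
  induction w with
  | nil => rfl
  | cons a w ih => rw [mulWord_cons, AutomaticAlgebra.zero_mul, ih]

theorem mulWord_mem_nonletters {x : AutomaticAlgebra δ} (hx : x ∈ nonletters δ) (w : List S) :
    mulWord x w ∈ nonletters δ := by
  induction w generalizing x with
  | nil => exact hx
  | cons a w ih => exact ih (mul_mem_nonletters _ _)

section

variable {N : Type (max u v)} [Mul N] (e : AutomaticAlgebra δ →ₙ* N)

/-- The composite of the `i`-th coordinate with an embedding `e`. -/
def coordHom {I : Type} (A : Subsemigroup (I → AutomaticAlgebra δ)) (i : I) : A →ₙ* N :=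
  e.comp ((Pi.evalMulHom _ i).comp (MulMemClass.subtype A))

theorem memISP_subsemigroup {e : AutomaticAlgebra δ →ₙ* N} (he : Function.Injective e) {I : Type}
    (A : Subsemigroup (I → AutomaticAlgebra δ)) : MemISP N A := by
  refine ⟨ULift I, MulHom.pi fun i => coordHom e A i.down, fun x y h => ?_⟩
  exact Subtype.ext (funext fun i => he (congrFun h ⟨i⟩))

/-- The ghost element method for subalgebras of powers. -/
theorem not_isDualizable_of_ghost_coord [Finite N] {e : AutomaticAlgebra δ →ₙ* N}
    (he : Function.Injective e) {I : Type} (A : Subsemigroup (I → AutomaticAlgebra δ))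
    (v : ℕ → A) (b : ℕ)
    (hv : ∀ (h : A →ₙ* N) (x y : N) (f g : Fin b ↪ ℕ), (∀ s, h (v (f s)) = x) →
      (∀ s, h (v (g s)) = y) → x = y)
    (hghost : ∀ c : A, ∃ i : I, {k | (v k).1 i = c.1 i}.Finite) :
    ¬ IsDualizable N := by
  refine not_isDualizable_of_ghost (memISP_subsemigroup he A) v b hv fun c => ?_
  obtain ⟨i, hi⟩ := hghost c
  exact ⟨coordHom e A i, hi.subset fun k hk => he hk⟩

end

/-! ### A ghost from mixtures of two words -/

/-- Replaces the value of the constant function `x` at the places in `s` by `y`. -/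
noncomputable def patch {I M : Type*} (x y : M) (s : Set I) : I → M :=
  open Classical in fun i => if i ∈ s then y else x

theorem patch_of_mem {I M : Type*} {x y : M} {s : Set I} {i : I} (h : i ∈ s) :
    patch x y s i = y := if_pos h

theorem patch_of_notMem {I M : Type*} {x y : M} {s : Set I} {i : I} (h : i ∉ s) :
    patch x y s i = x := if_neg h

theorem map_foldl_mul {A B : Type*} [Mul A] [Mul B] (f : A →ₙ* B) (x : A) (l : List A) :
    f (l.foldl (· * ·) x) = (l.map f).foldl (· * ·) (f x) := by
  induction l generalizing x with
  | nil => rfl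
  | cons a l ih => simp [ih]

theorem mulWord_eq_foldl (x : AutomaticAlgebra δ) (w : List S) :
    mulWord x w = (w.map letter).foldl (· * ·) x := by
  rw [mulWord, List.foldl_map]

/-- The subalgebra of `M ^ ℕ` that consists of the tuples of letters that are constant except in
one place and of the tuples of states and zeros with at least one zero. -/
def mixtureAlgebra (δ : Q → S → Option Q) : Subsemigroup (ℕ → AutomaticAlgebra δ) where
  carrier := {z | (∃ c d : S, ∃ j : ℕ, z = patch (letter c) (letter d) {j}) ∨
    ((∀ i, z i ∈ nonletters δ) ∧ ∃ i, z i = 0)}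
  mul_mem' := by
    rintro x y hx -
    refine Or.inr ⟨fun i => mul_mem_nonletters _ _, ?_⟩
    rcases hx with ⟨c, d, j, rfl⟩ | ⟨-, i, hi⟩
    · refine ⟨j, ?_⟩
      rw [Pi.mul_apply, patch_of_mem (Set.mem_singleton j)]
      exact mul_eq_zero_of_left (letter_notMem_states d) _
    · exact ⟨i, by rw [Pi.mul_apply, hi, AutomaticAlgebra.zero_mul]⟩

/-- If a state is sent to the same state by two words of the same length but some mixture of
these words sends it to zero, then the algebra is inherently non-dualizable. -/
theorem not_isDualizable_of_mixture [Finite S] {N : Type (max u v)} [Mul N] [Finite N]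
    {e : AutomaticAlgebra δ →ₙ* N} (he : Function.Injective e) (p : AutomaticAlgebra δ)
    (hp : p ∈ nonletters δ) (l : List (S × S × Bool))
    (h₁ : mulWord p (l.map fun t => t.1) = mulWord p (l.map fun t => t.2.1))
    (h₀ : mulWord p (l.map fun t => t.1) ≠ 0)
    (h₂ : mulWord p (l.map fun t => bif t.2.2 then t.2.1 else t.1) = 0) :
    ¬ IsDualizable N := by
  classical
  set r := mulWord p (l.map fun t => t.1) with hr
  have hrn : r ∈ nonletters δ := mulWord_mem_nonletters hp _
  let L : S → S → ℕ → mixtureAlgebra δ := fun c d j =>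
    ⟨patch (letter c) (letter d) {j}, Or.inl ⟨c, d, j, rfl⟩⟩
  have hpatch : ∀ x ∈ nonletters δ, ∀ Z : Set ℕ, Z.Nonempty →
      patch x 0 Z ∈ mixtureAlgebra δ := by
    rintro x hx Z ⟨i, hi⟩
    refine Or.inr ⟨fun j => ?_, i, patch_of_mem hi⟩
    by_cases hj : j ∈ Z
    · rw [patch_of_mem hj]
      exact zero_mem_nonletters
    · rwa [patch_of_notMem hj]
  let V : ∀ x ∈ nonletters δ, ∀ Z : Set ℕ, Z.Nonempty → mixtureAlgebra δ :=
    fun x hx Z hZ => ⟨patch x 0 Z, hpatch x hx Z hZ⟩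
  let W : ℕ → List (mixtureAlgebra δ) := fun j => l.map fun t => L t.1 t.2.1 j
  -- The marked letters have their exceptional place moved from `j` to `k`, so coordinate `k` reads
  -- the mixture.
  let W' : ℕ → ℕ → List (mixtureAlgebra δ) := fun j k =>
    l.map fun t => L t.1 t.2.1 (bif t.2.2 then k else j)
  have coord : ∀ (x : mixtureAlgebra δ) (f : S × S × Bool → mixtureAlgebra δ)
      (g : S × S × Bool → S) (i : ℕ), (∀ t, (f t).1 i = letter (g t)) →
      ((l.map f).foldl (· * ·) x).1 i = mulWord (x.1 i) (l.map g) := by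
    intro x f g i hfg
    rw [mulWord_eq_foldl]
    refine (map_foldl_mul ((Pi.evalMulHom _ i).comp (MulMemClass.subtype (mixtureAlgebra δ)))
      x _).trans ?_
    rw [List.map_map, List.map_map]
    congr 1
    exact List.map_congr_left fun t _ => hfg t
  have hL : ∀ c d j i, (L c d j).1 i = letter (if i = j then d else c) := by
    intro c d j i
    by_cases h : i = j
    · exact (patch_of_mem h).trans (by rw [if_pos h])
    · exact (patch_of_notMem h).trans (by rw [if_neg h])
  have hW : ∀ Z hZ j, (W j).foldl (· * ·) (V p hp Z hZ) = V r hrn Z hZ := by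
    intro Z hZ j
    refine Subtype.ext (funext fun i => ?_)
    rw [coord _ _ _ i fun t => hL _ _ j i]
    change mulWord (patch p 0 Z i) _ = patch r 0 Z i
    by_cases hi : i ∈ Z
    · rw [patch_of_mem hi, patch_of_mem hi, mulWord_zero]
    · rw [patch_of_notMem hi, patch_of_notMem hi]
      by_cases h : i = j
      · simp only [if_pos h, ← h₁]
      · simp only [if_neg h, ← hr]
  -- The starting tuples can differ only at `k`, where the mixture sends `p` to zero anyway.
  have hW' : ∀ i j k, j ≠ k → (W' j k).foldl (· * ·) (V p hp {i} (Set.singleton_nonempty _)) =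
      (W' j k).foldl (· * ·) (V p hp {i, k} (Set.insert_nonempty _ _)) := by
    intro i j k hjk
    refine Subtype.ext (funext fun m => ?_)
    rw [coord _ _ _ m fun t => hL _ _ _ m, coord _ _ _ m fun t => hL _ _ _ m]
    change mulWord (patch p 0 {i} m) _ = mulWord (patch p 0 {i, k} m) _
    by_cases hi : m = i
    · rw [patch_of_mem (Set.mem_singleton_iff.2 hi), patch_of_mem (Set.mem_insert_iff.2 (Or.inl hi))]
    by_cases hk : m = k
    · rw [patch_of_notMem (Set.mem_singleton_iff.not.2 hi),
        patch_of_mem (i := m) (s := {i, k}) (by simp [hk]), mulWord_zero, ← h₂]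
      congr 2
      funext t
      cases t.2.2
      · simp [hk, hjk.symm]
      · simp [hk]
    · rw [patch_of_notMem (Set.mem_singleton_iff.not.2 hi), patch_of_notMem (by simp [hi, hk])]
  -- If `h` confuses the letter tuples at `j` and `k`, it confuses `W j` with `W' j k`, so it cannot
  -- detect an extra zero at `k`.
  have link : ∀ (h : mixtureAlgebra δ →ₙ* N) (i j k : ℕ), j ≠ k →
      (∀ c d, h (L c d j) = h (L c d k)) →
      h (V r hrn {i} (Set.singleton_nonempty _)) = h (V r hrn {i, k} (Set.insert_nonempty _ _)) := by
    intro h i j k hjk hh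
    have hmap : (W j).map h = (W' j k).map h := by
      rw [List.map_map, List.map_map]
      refine List.map_congr_left fun t _ => ?_
      simp only [Function.comp_apply]
      cases t.2.2
      · rfl
      · exact hh _ _
    rw [← hW {i} (Set.singleton_nonempty _) j,
      ← hW {i, k} (Set.insert_nonempty _ _) j, map_foldl_mul, map_foldl_mul, hmap, ← map_foldl_mul,
      ← map_foldl_mul, hW' i j k hjk]
  -- The ghost is the constant tuple `r`, which has no zero. The bound lets the pigeonhole principle
  -- find two places in each fibre that `h` confuses.
  refine not_isDualizable_of_ghost_coord he (mixtureAlgebra δ)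
    (fun i => V r hrn {i} (Set.singleton_nonempty _)) (Nat.card (S → S → N) + 1) ?_ ?_
  · intro h x y f g hf hg
    have pigeon : ∀ f : Fin (Nat.card (S → S → N) + 1) ↪ ℕ, ∃ i j, f i ≠ f j ∧
        ∀ c d, h (L c d (f i)) = h (L c d (f j)) := by
      intro f
      have := Fintype.ofFinite (S → S → N)
      obtain ⟨i, j, hij, hh⟩ := Fintype.exists_ne_map_eq_of_card_lt
        (fun s c d => h (L c d (f s))) (by simp [Nat.card_eq_fintype_card])
      exact ⟨i, j, f.injective.ne hij, fun c d => congrFun (congrFun hh c) d⟩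
    obtain ⟨i, i', hi, hi'⟩ := pigeon f
    obtain ⟨k, k', hk, hk'⟩ := pigeon g
    rw [← hf i, ← hg k, link h (f i) (g k') (g k) hk.symm fun c d => (hk' c d).symm,
      link h (g k) (f i') (f i) hi.symm fun c d => (hi' c d).symm]
    simp only [Set.pair_comm (f i) (g k)]
  · rintro ⟨z, ⟨c, d, j, rfl⟩ | ⟨-, i, hi⟩⟩
    · refine ⟨j, Set.Finite.subset Set.finite_empty fun k hk => ?_⟩
      change patch r 0 {k} j = patch (letter c) (letter d) {j} j at hk
      rw [patch_of_mem (Set.mem_singleton j)] at hk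
      by_cases hjk : j ∈ ({k} : Set ℕ)
      · rw [patch_of_mem hjk] at hk
        exact letter_ne_zero d hk.symm
      · rw [patch_of_notMem hjk] at hk
        exact hrn d hk
    · refine ⟨i, (Set.finite_singleton i).subset fun k hk => ?_⟩
      change patch r 0 {k} i = z i at hk
      by_contra hik
      rw [patch_of_notMem fun h => hik (Set.mem_singleton_iff.2 (Set.mem_singleton_iff.1 h).symm), hi] at hk
      exact h₀ hk

/-! ### A ghost from a preserved relation -/

/-- Coordinates: a base point, the natural numbers, and a point for each pair of sets. -/
abbrev Coord : Type := Option (ℕ ⊕ Set ℕ × Set ℕ)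

/-- Extends `F ⊆ ℕ` to a set of coordinates so that it meets `Coord.rightSet G`, for each `G`,
outside of the base point. -/
def Coord.leftSet (F : Set ℕ) : Set Coord :=
  {i | i = none ∨ (∃ k ∈ F, i = some (.inl k)) ∨ ∃ G, Disjoint F G ∧ i = some (.inr (F, G))}

/-- Extends `G ⊆ ℕ` to a set of coordinates so that it meets `Coord.leftSet F`, for each `F`,
outside of the base point. -/
def Coord.rightSet (G : Set ℕ) : Set Coord :=
  {i | i = none ∨ (∃ k ∈ G, i = some (.inl k)) ∨ ∃ F, i = some (.inr (F, G))}

theorem Coord.none_mem_leftSet (F : Set ℕ) : none ∈ leftSet F := Or.inl rfl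

theorem Coord.none_mem_rightSet (G : Set ℕ) : none ∈ rightSet G := Or.inl rfl

theorem Coord.inl_mem_leftSet {F : Set ℕ} {k : ℕ} (h : k ∈ F) : some (.inl k) ∈ leftSet F :=
  Or.inr (Or.inl ⟨k, h, rfl⟩)

theorem Coord.exists_mem_leftSet_mem_rightSet (F G : Set ℕ) :
    ∃ i ≠ none, i ∈ leftSet F ∧ i ∈ rightSet G := by
  by_cases h : Disjoint F G
  · exact ⟨some (.inr (F, G)), nofun, Or.inr (Or.inr ⟨G, h, rfl⟩), Or.inr (Or.inr ⟨F, rfl⟩)⟩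
  · obtain ⟨k, hF, hG⟩ := Set.not_disjoint_iff.1 h
    exact ⟨some (.inl k), nofun, Or.inr (Or.inl ⟨k, hF, rfl⟩), Or.inr (Or.inl ⟨k, hG, rfl⟩)⟩

/-- `leftSet F` has pair points only for sets disjoint from `F`, so none of them survives here. -/
theorem Coord.leftSet_inter_rightSet {F G : Set ℕ} {k : ℕ} (h : F ∩ G = {k}) :
    leftSet F ∩ rightSet G = {none, some (.inl k)} := by
  have hk : k ∈ F ∩ G := h ▸ Set.mem_singleton k
  ext i
  constructor
  · rintro ⟨rfl | ⟨l, hl, rfl⟩ | ⟨G', hG', rfl⟩, hi⟩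
    · exact Or.inl rfl
    · rcases hi with hi | ⟨l', hl', hi⟩ | ⟨F', hi⟩
      · cases hi
      · cases hi
        have : l ∈ F ∩ G := ⟨hl, hl'⟩
        rw [h] at this
        rw [Set.mem_singleton_iff.1 this]
        exact Or.inr rfl
      · cases hi
    · rcases hi with hi | ⟨l', hl', hi⟩ | ⟨F', hi⟩
      · cases hi
      · cases hi
      · cases hi
        exact absurd hk.2 (Set.disjoint_left.1 hG' hk.1)
  · rintro (rfl | rfl)
    · exact ⟨Or.inl rfl, Or.inl rfl⟩
    · exact ⟨Or.inr (Or.inl ⟨k, hk.1, rfl⟩), Or.inr (Or.inl ⟨k, hk.2, rfl⟩)⟩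

/-- Let `q` be a state and `c` a letter such that `q b cᵐ = 0`, where `b` is a letter or `0`, and
assume that a relation that is preserved by right multiplication by `(c, c)` and `(c, b)`
contains `(0, 0)` and `(q c, q c)` but not `(q c cᵐ, 0)`. Then the algebra is inherently
non-dualizable. -/
theorem not_isDualizable_of_rel {N : Type (max u v)} [Mul N] [Finite N]
    {e : AutomaticAlgebra δ →ₙ* N} (he : Function.Injective e) {q b : AutomaticAlgebra δ} {c : S}
    (hq : q ∈ states δ) (hb : b ∉ states δ) (m : ℕ)
    (R : AutomaticAlgebra δ → AutomaticAlgebra δ → Prop) (h₀ : R 0 0)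
    (hqc : R (q * letter c) (q * letter c))
    (hc : ∀ s t, R s t → R (s * letter c) (t * letter c))
    (hcb : ∀ s t, R s t → R (s * letter c) (t * b))
    (hkill : mulWord (q * b) (List.replicate m c) = 0)
    (hR : ¬ R (mulWord (q * letter c) (List.replicate m c)) 0) : ¬ IsDualizable N := by
  classical
  set g := mulWord (q * letter c) (List.replicate m c) with hg
  have hgn : g ∈ nonletters δ := mulWord_mem_nonletters (mul_mem_nonletters _ _) _
  have hqn := (mem_states_iff.1 hq).1
  have hpn : ∀ U i, patch (I := Coord) 0 q U i ∈ nonletters δ := by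
    intro U i
    by_cases h : i ∈ U
    · rwa [patch_of_mem h]
    · rw [patch_of_notMem h]
      exact zero_mem_nonletters
  -- The ghost will be `g` at the base point and zero elsewhere; the last clause excludes it because
  -- `R g 0` fails. Letter tuples must meet every `leftSet` off the base point so that products
  -- satisfy that clause.
  let A : Subsemigroup (Coord → AutomaticAlgebra δ) :=
    { carrier := {z | (∃ F : Set ℕ, F.Nonempty ∧ z = patch 0 q (Coord.leftSet F)) ∨
        (∃ T : Set Coord, none ∈ T ∧
          (∀ F : Set ℕ, F.Nonempty → ∃ i ≠ none, i ∈ Coord.leftSet F ∧ i ∈ T) ∧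
          z = patch b (letter c) T) ∨
        ((∀ i, z i ∈ nonletters δ) ∧ ∃ i ≠ none, R (z none) (z i))}
      mul_mem' := by
        intro x y hx hy
        refine Or.inr (Or.inr ⟨fun i => mul_mem_nonletters _ _, ?_⟩)
        have hzero : x * y = 0 → ∃ i ≠ none, R ((x * y) none) ((x * y) i) := fun h =>
          ⟨some (.inl 0), nofun, by rw [h]; exact h₀⟩
        rcases hy with ⟨F, -, rfl⟩ | ⟨T, hT, hT', rfl⟩ | ⟨hy, -⟩
        · exact hzero (funext fun i => mul_eq_zero_of_right _ (hpn _ i))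
        · rcases hx with ⟨F, hF, rfl⟩ | ⟨U, -, -, rfl⟩ | ⟨hx, i, hi, hi'⟩
          · obtain ⟨i, hi, hiF, hiT⟩ := hT' F hF
            refine ⟨i, hi, ?_⟩
            rw [Pi.mul_apply, Pi.mul_apply, patch_of_mem hiF, patch_of_mem hiT, patch_of_mem hT,
              patch_of_mem (Coord.none_mem_leftSet F)]
            exact hqc
          · refine hzero (funext fun i => mul_eq_zero_of_left ?_ _)
            by_cases h : i ∈ U
            · rw [patch_of_mem h]
              exact letter_notMem_states c
            · rwa [patch_of_notMem h]
          · refine ⟨i, hi, ?_⟩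
            rw [Pi.mul_apply, Pi.mul_apply, patch_of_mem hT]
            by_cases h : i ∈ T
            · rw [patch_of_mem h]
              exact hc _ _ hi'
            · rw [patch_of_notMem h]
              exact hcb _ _ hi'
        · exact hzero (funext fun i => mul_eq_zero_of_right _ (hy i)) }
  let X : ∀ F : Set ℕ, F.Nonempty → A := fun F hF => ⟨_, Or.inl ⟨F, hF, rfl⟩⟩
  let Y : Set ℕ → A := fun G => ⟨_, Or.inr (Or.inl ⟨Coord.rightSet G, Coord.none_mem_rightSet G,
    fun F _ => Coord.exists_mem_leftSet_mem_rightSet F G, rfl⟩)⟩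
  let C : A := ⟨_, Or.inr (Or.inl ⟨Set.univ, Set.mem_univ _, fun F hF =>
    ⟨some (.inl hF.some), nofun, Coord.inl_mem_leftSet hF.some_mem, Set.mem_univ _⟩, rfl⟩)⟩
  -- Places in `leftSet F` outside `rightSet G` carry `q b cᵐ = 0`, so only the intersection
  -- survives.
  let P : ∀ F : Set ℕ, F.Nonempty → Set ℕ → A := fun F hF G =>
    (List.replicate m C).foldl (· * ·) (X F hF * Y G)
  have hP : ∀ F hF G k, F ∩ G = {k} → (P F hF G).1 = patch 0 g {none, some (.inl k)} := by
    intro F hF G k hk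
    funext i
    have h1 : (P F hF G).1 i = mulWord ((X F hF * Y G).1 i) (List.replicate m c) := by
      rw [mulWord_eq_foldl]
      refine (map_foldl_mul ((Pi.evalMulHom _ i).comp (MulMemClass.subtype A)) _ _).trans ?_
      rw [List.map_replicate, List.map_replicate]
      congr 2
      exact patch_of_mem (Set.mem_univ i)
    have h2 : (X F hF * Y G).1 i =
      patch 0 q (Coord.leftSet F) i * patch b (letter c) (Coord.rightSet G) i := rfl
    rw [h1, h2, ← Coord.leftSet_inter_rightSet hk]
    by_cases hiF : i ∈ Coord.leftSet F
    · by_cases hiG : i ∈ Coord.rightSet G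
      · rw [patch_of_mem hiF, patch_of_mem hiG, patch_of_mem (Set.mem_inter hiF hiG)]
      · rw [patch_of_mem hiF, patch_of_notMem hiG, 
          patch_of_notMem (mt Set.mem_of_mem_inter_right hiG), hkill]
    · rw [patch_of_notMem hiF, patch_of_notMem (mt Set.mem_of_mem_inter_left hiF),
        AutomaticAlgebra.zero_mul, mulWord_zero]
  let V : ℕ → A := fun k => P {k} (Set.singleton_nonempty k) {k}
  have hV : ∀ k, (V k).1 = patch 0 g {none, some (.inl k)} := fun k =>
    hP _ (Set.singleton_nonempty k) _ _ (Set.inter_self _)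
  have hPV : ∀ F hF G k, F ∩ G = {k} → P F hF G = V k := fun F hF G k hk =>
    Subtype.ext ((hP F hF G k hk).trans (hV k).symm)
  refine not_isDualizable_of_ghost_coord he A V (Nat.card N + 1) ?_ ?_
  · intro h x y f f' hf hf'
    by_contra hxy
    have hne : ∀ i j, f i ≠ f' j := fun i j hij => hxy (by rw [← hf i, ← hf' j, hij])
    have := Fintype.ofFinite N
    obtain ⟨i, k, hik, hh⟩ := Fintype.exists_ne_map_eq_of_card_lt
      (fun s => h (X {f s, f' s} (Set.insert_nonempty _ _))) (by simp [Nat.card_eq_fintype_card])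
    -- `G` selects `f' i` from the `i`-th pair and `f k` from the `k`-th; as `h` confuses the two
    -- pairs, it merges `y` with `x`.
    let G : Set ℕ := {l | l = f' i ∨ ∃ s, s ≠ i ∧ l = f s}
    have h1 : ({f i, f' i} : Set ℕ) ∩ G = {f' i} := by
      ext l
      constructor
      · rintro ⟨rfl | rfl, hl⟩
        · rcases hl with hl | ⟨s, hs, hl⟩
          · exact hl
          · exact absurd (f.injective hl).symm hs
        · rfl
      · rintro rfl
        exact ⟨Or.inr rfl, Or.inl rfl⟩
    have h2 : ({f k, f' k} : Set ℕ) ∩ G = {f k} := by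
      ext l
      constructor
      · rintro ⟨rfl | rfl, hl⟩
        · rfl
        · rcases hl with hl | ⟨s, hs, hl⟩
          · exact absurd (f'.injective hl).symm hik
          · exact absurd hl.symm (hne _ _)
      · rintro rfl
        exact ⟨Or.inl rfl, Or.inr ⟨k, hik.symm, rfl⟩⟩
    refine hxy ?_
    rw [← hf k, ← hf' i, ← hPV _ (Set.insert_nonempty _ _) _ _ h1,
      ← hPV _ (Set.insert_nonempty _ _) _ _ h2, map_foldl_mul, map_foldl_mul, map_mul, map_mul]
    exact congrArg (fun z => ((List.replicate m C).map h).foldl (· * ·) (z * h (Y G))) hh.symm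
  · have aux : ∀ z : A, (z.1 none ≠ g ∨ ∃ i ≠ none, z.1 i ≠ 0) →
        ∃ i, {k | (V k).1 i = z.1 i}.Finite := by
      rintro z (hz | ⟨i, hi, hz⟩)
      · refine ⟨none, Set.finite_empty.subset fun k hk => ?_⟩
        rw [Set.mem_ofPred_eq, hV, patch_of_mem (Set.mem_insert _ _)] at hk
        exact hz hk.symm
      · refine ⟨i, ((Set.finite_singleton i).preimage
          (f := fun k : ℕ => (some (.inl k) : Coord)) (fun _ _ _ _ h => by simpa using h)).subset
          fun k hk => ?_⟩
        rw [Set.mem_ofPred_eq, hV] at hk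
        by_contra hik
        rw [patch_of_notMem] at hk
        · exact hz hk.symm
        · rintro (h | h)
          · exact hi h
          · exact hik h.symm
    rintro ⟨z, ⟨F, hF, rfl⟩ | ⟨T, hT, -, rfl⟩ | ⟨-, i, hi, hi'⟩⟩
    · refine aux _ (Or.inr ⟨some (.inl hF.some), nofun, ?_⟩)
      change patch 0 q (Coord.leftSet F) _ ≠ 0
      rw [patch_of_mem (Coord.inl_mem_leftSet hF.some_mem)]
      exact (mem_states_iff.1 hq).2
    · refine aux _ (Or.inl ?_)
      change patch b (letter c) T none ≠ g
      rw [patch_of_mem hT]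
      exact (hgn c).symm
    · refine aux _ (or_iff_not_imp_left.2 fun h => ⟨i, hi, fun h' => hR ?_⟩)
      have hz : z none = g := not_not.1 h
      have hz' : z i = 0 := h'
      rwa [hz, hz'] at hi'

end AutomaticAlgebra

/-! ### Letters in subalgebras of dualizable algebras -/

/-- The orbit of `x` is eventually periodic; any multiple of the period beyond the preperiod serves
as `m`. -/
theorem exists_dvd_iterate_add_self {α : Type*} [Finite α] (f : α → α) (x : α) {K : ℕ}
    (hK : 1 ≤ K) : ∃ m, 2 ≤ m ∧ K ∣ m ∧ f^[m + m] x = f^[m] x := by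
  obtain ⟨i, j, hij, h⟩ : ∃ i j, i < j ∧ f^[i] x = f^[j] x := by
    obtain ⟨i, j, hij, h⟩ := Finite.exists_ne_map_eq_of_infinite fun i => f^[i] x
    rcases lt_or_gt_of_ne hij with h' | h'
    · exact ⟨i, j, h', h⟩
    · exact ⟨j, i, h', h.symm⟩
  obtain ⟨d, hd, rfl⟩ : ∃ d, 1 ≤ d ∧ j = i + d := ⟨j - i, by omega, by omega⟩
  have period : ∀ l s, i ≤ s → f^[s + l * d] x = f^[s] x := by
    intro l
    induction l with
    | zero => simp
    | succ l ih =>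
      intro s hs
      obtain ⟨t, rfl⟩ := Nat.exists_eq_add_of_le hs
      rw [show i + t + (l + 1) * d = i + t + d + l * d by ring, ih _ (by omega),
        show i + t + d = t + (i + d) by ring, Function.iterate_add_apply, ← h,
        ← Function.iterate_add_apply, add_comm t]
  have hm : i + 2 ≤ (i + 2) * K * d := by
    rw [mul_assoc]
    exact Nat.le_mul_of_pos_right _ (Nat.mul_pos hK hd)
  refine ⟨(i + 2) * K * d, by omega, ⟨(i + 2) * d, by ring⟩, period _ _ (by omega)⟩

namespace AutomaticAlgebra

variable {Q : Type u} {S : Type v} {δ : Q → S → Option Q}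

theorem mulWord_concat (x : AutomaticAlgebra δ) (w : List S) (a : S) :
    mulWord x (w ++ [a]) = mulWord x w * letter a := by
  rw [mulWord_append, mulWord_cons, mulWord_nil]

theorem mem_states_of_mul_ne_zero {x y : AutomaticAlgebra δ} (h : x * y ≠ 0) : x ∈ states δ :=
  not_not.1 fun hx => h (mul_eq_zero_of_left hx y)

theorem ne_zero_of_mulWord_ne_zero {x : AutomaticAlgebra δ} {w : List S} (h : mulWord x w ≠ 0) :
    x ≠ 0 := by
  rintro rfl
  exact h (mulWord_zero w)

theorem mulWord_flatten_replicate (x : AutomaticAlgebra δ) (w : List S) (m : ℕ) :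
    mulWord x (List.replicate m w).flatten = (fun y => mulWord y w)^[m] x := by
  induction m generalizing x with
  | zero => rfl
  | succ m ih =>
    rw [List.replicate_succ, List.flatten_cons, mulWord_append, ih, Function.iterate_succ_apply]

theorem mulWord_replicate_mul {x : AutomaticAlgebra δ} {a : S} {k : ℕ}
    (h : mulWord x (List.replicate k a) = x) (l : ℕ) :
    mulWord x (List.replicate (k * l) a) = x := by
  induction l with
  | zero => rfl
  | succ l ih => rw [Nat.mul_succ, List.replicate_add, mulWord_append, ih, h]

variable {N : Type (max u v)} [Mul N] [Finite N] {e : AutomaticAlgebra δ →ₙ* N}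

/-- In a subalgebra of a dualizable algebra, each letter permutes its range. -/
theorem exists_mulWord_replicate_eq (he : Function.Injective e) (hN : IsDualizable N)
    {q : AutomaticAlgebra δ} {a : S} (hq : q * letter a ≠ 0) :
    ∃ k, 1 ≤ k ∧ mulWord (q * letter a) (List.replicate k a) = q * letter a := by
  by_contra! H
  have hsucc : ∀ s, (∃ k, 1 ≤ k ∧ s = mulWord (q * letter a) (List.replicate k a)) →
      ∃ k, 1 ≤ k ∧ s * letter a = mulWord (q * letter a) (List.replicate k a) := by
    rintro s ⟨k, hk, rfl⟩
    exact ⟨k + 1, by omega, by rw [List.replicate_succ', mulWord_concat]⟩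
  have step : ∀ s t t', (s = 0 ∨ (∃ k, 1 ≤ k ∧ s = mulWord (q * letter a) (List.replicate k a)) ∨
      (s = q * letter a ∧ t = q * letter a)) → (s * letter a = 0 ∨
      (∃ k, 1 ≤ k ∧ s * letter a = mulWord (q * letter a) (List.replicate k a)) ∨
      (s * letter a = q * letter a ∧ t' = q * letter a)) := by
    rintro s t t' (rfl | h | ⟨rfl, -⟩)
    · exact Or.inl (AutomaticAlgebra.zero_mul _)
    · exact Or.inr (Or.inl (hsucc s h))
    · exact Or.inr (Or.inl ⟨1, le_rfl, rfl⟩)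
  -- The relation asks for `t = q a` only while `s` has not moved on from `q a`; as `q a` never
  -- recurs, `(q a, 0)` stays excluded.
  refine not_isDualizable_of_rel he (mem_states_of_mul_ne_zero hq) zero_notMem_states (c := a) 0
    (fun s t => s = 0 ∨ (∃ k, 1 ≤ k ∧ s = mulWord (q * letter a) (List.replicate k a)) ∨
      (s = q * letter a ∧ t = q * letter a)) (Or.inl rfl) (Or.inr (Or.inr ⟨rfl, rfl⟩))
    (fun s t => step s t _) (fun s t => step s t _) (AutomaticAlgebra.mul_zero _) ?_ hN
  rintro (h | ⟨k, hk, h⟩ | ⟨-, h⟩)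
  · exact hq h
  · exact H k hk h.symm
  · exact hq h.symm

/-- In a subalgebra of a dualizable algebra, no path leads from `ran a` to a kill state of `a`. -/
theorem mulWord_mul_letter_ne_zero (he : Function.Injective e) (hN : IsDualizable N)
    (w : List S) {q : AutomaticAlgebra δ} {a : S} (hw : mulWord (q * letter a) w ≠ 0) :
    mulWord (q * letter a) w * letter a ≠ 0 := by
  induction hn : w.length using Nat.strong_induction_on generalizing w q a with
  | _ n ih =>
  intro hdead
  set p := q * letter a with hp
  obtain ⟨k, hk, hcyc⟩ := exists_mulWord_replicate_eq he hN (ne_zero_of_mulWord_ne_zero hw)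
  rw [← hp] at hcyc
  rcases n.eq_zero_or_pos with rfl | hpos
  · rw [List.length_eq_zero_iff.1 hn] at hw hdead
    obtain ⟨l, rfl⟩ := Nat.exists_eq_add_of_le' hk
    rw [List.replicate_succ, mulWord_cons] at hcyc
    rw [mulWord_nil] at hw hdead
    rw [hdead, mulWord_zero] at hcyc
    exact hw hcyc.symm
  have := Finite.of_injective e he
  have : Finite S := Finite.of_injective (letter (δ := δ)) fun _ _ h => by simpa using h
  -- The periodic word `w w w ⋯`, with prefix images `P i` of `p`.
  let u : ℕ → S := fun i => w[i % n]'(hn.symm ▸ Nat.mod_lt i hpos)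
  have hu : ∀ i, u (i + n) = u i := fun i => by simp [u]
  let P : ℕ → AutomaticAlgebra δ := fun i => mulWord p ((List.range i).map u)
  have hPsucc : ∀ i, P (i + 1) = P i * letter (u i) := fun i => by
    simp only [P, List.range_succ, List.map_append, mulWord_append]
    rfl
  have hPadd : ∀ i l, ∃ t : List S, t.length = l ∧ P (i + l) = mulWord (P i) t := by
    intro i l
    refine ⟨(List.range l).map fun j => u (i + j), by simp, ?_⟩
    simp only [P, List.range_add, List.map_append, mulWord_append, List.map_map]
    rfl
  have hwu : (List.range n).map u = w := by
    refine List.ext_getElem (by simp [hn]) fun i h1 h2 => ?_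
    have : i < n := by simpa using h1
    simp [u, Nat.mod_eq_of_lt this]
  have hPn : ∀ i, P (i * n) = (fun y => mulWord y w)^[i] p := by
    intro i
    induction i with
    | zero => simp [P]
    | succ i hi =>
      have : (fun j => u (i * n + j)) = u := by
        funext j
        simp [u]
      rw [Function.iterate_succ_apply', ← hi, Nat.succ_mul]
      simp only [P, List.range_add, List.map_append, mulWord_append, List.map_map]
      rw [← hwu]
      exact congrArg (fun g => mulWord _ ((List.range n).map g)) this
  have alive : ∀ i, P i ≠ 0 := by
    intro i
    induction i using Nat.strong_induction_on with
    | _ i hi =>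
    rcases le_or_gt i n with hin | hin
    · obtain ⟨t, -, ht⟩ := hPadd i (n - i)
      have h1 : P n ≠ 0 := by simpa [P, hwu] using hw
      rw [show i + (n - i) = n by omega] at ht
      rw [ht] at h1
      exact ne_zero_of_mulWord_ne_zero h1
    -- `P (j + 1)` lies in the range of `u j`, and `n - 1` letters later the same letter is read
    -- again: a shorter instance of the claim.
    · obtain ⟨j, rfl⟩ : ∃ j, i = j + n + 1 := ⟨i - n - 1, by omega⟩
      obtain ⟨t, ht, hPt⟩ := hPadd (j + 1) (n - 1)
      rw [show j + 1 + (n - 1) = j + n by omega, hPsucc] at hPt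
      rw [hPsucc, hu, hPt]
      refine ih (n - 1) (by omega) t ?_ ht
      rw [← hPt]
      exact hi _ (by omega)
  -- Divisibility by `k` makes `a^|w^m|` fix `p`; `m ≥ 2` makes `Z` nonempty, so that the mixture
  -- reads an `a` right after `w`.
  obtain ⟨m, hm, hkm, hidem⟩ := exists_dvd_iterate_add_self (fun y => mulWord y w) p hk
  obtain ⟨l, rfl⟩ := Nat.exists_eq_add_of_le' hm
  set Z := (List.replicate (l + 1) w).flatten with hZ
  have hY : (List.replicate (l + 2) w).flatten = w ++ Z := by
    rw [List.replicate_succ, List.flatten_cons]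
  have hlen : (w ++ Z).length = (l + 2) * n := by
    rw [← hY]
    simp [hn]
  have hpa : mulWord p (List.replicate w.length a ++ List.replicate Z.length a) = p := by
    obtain ⟨d, hd⟩ := hkm
    rw [← List.replicate_add, ← List.length_append, hlen, hd, mul_assoc]
    exact mulWord_replicate_mul hcyc _
  have hpY : mulWord p (w ++ Z) = (fun y => mulWord y w)^[l + 2] p := by
    rw [← hY, mulWord_flatten_replicate]
  -- With `Y = w Z`, the words are `a^|Y| Y` and `Y Y`, and the mixture is `w a^|Z| Y`.
  refine not_isDualizable_of_mixture he p (mul_mem_nonletters _ _)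
    ((w.map fun d => (a, d, true)) ++ (Z.map fun d => (a, d, false)) ++
      ((w ++ Z).map fun d => (d, d, false))) ?_ ?_ ?_ hN
  · have h1 : mulWord p (w ++ Z ++ (w ++ Z)) = mulWord p (w ++ Z) := by
      rw [mulWord_append, ← hY, mulWord_flatten_replicate, mulWord_flatten_replicate,
        ← Function.iterate_add_apply, hidem]
    simp only [List.map_append, List.map_map, Function.comp_def, List.map_const', List.map_id']
    rw [mulWord_append, hpa, h1]
  · simp only [List.map_append, List.map_map, Function.comp_def, List.map_const', List.map_id']
    rw [mulWord_append, hpa, hpY, ← hPn]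
    exact alive _
  · simp only [List.map_append, List.map_map, Function.comp_def, List.map_const', List.map_id',
      cond_true, cond_false]
    obtain ⟨j, hj⟩ : ∃ j, Z.length = j + 1 := by
      refine Nat.exists_eq_add_one.2 ?_
      rw [hZ, List.replicate_succ, List.flatten_cons, List.length_append, hn]
      omega
    rw [hj, List.replicate_succ, mulWord_append, mulWord_append p, mulWord_cons, hdead,
      mulWord_zero, mulWord_zero]

/-! ### Immortal states and edges leaving kill states -/

/-- If no word in the letters `c`, `d` sends `q c` to zero, but `q d cᵐ = 0`, then the algebra is
inherently non-dualizable. -/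
theorem not_isDualizable_of_immortal (he : Function.Injective e) {q : AutomaticAlgebra δ}
    {c d : S} (m : ℕ)
    (himm : ∀ w : List S, (∀ x ∈ w, x = c ∨ x = d) → mulWord (q * letter c) w ≠ 0)
    (hkill : mulWord (q * letter d) (List.replicate m c) = 0) : ¬ IsDualizable N := by
  have step : ∀ s t : AutomaticAlgebra δ, ∀ b, (b = c ∨ b = d) →
      (s = 0 ∨ ∀ w : List S, (∀ x ∈ w, x = c ∨ x = d) → mulWord t w ≠ 0) →
      (s * letter c = 0 ∨
        ∀ w : List S, (∀ x ∈ w, x = c ∨ x = d) → mulWord (t * letter b) w ≠ 0) := by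
    rintro s t b hb (rfl | h)
    · exact Or.inl (AutomaticAlgebra.zero_mul _)
    · exact Or.inr fun w hw => h (b :: w) (List.forall_mem_cons.2 ⟨hb, hw⟩)
  -- Immortality of `t` persists under both letters, and zero is not immortal.
  refine not_isDualizable_of_rel he (mem_states_of_mul_ne_zero (himm [] (by simp)))
    (letter_notMem_states d) (c := c) m
    (fun s t => s = 0 ∨ ∀ w : List S, (∀ x ∈ w, x = c ∨ x = d) → mulWord t w ≠ 0)
    (Or.inl rfl) (Or.inr himm) (fun s t => step s t c (Or.inl rfl))
    (fun s t => step s t d (Or.inr rfl)) hkill ?_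
  rintro (h | h)
  · exact himm _ (fun x hx => Or.inl (List.eq_of_mem_replicate hx)) h
  · exact h [] (by simp) rfl

/-- In a subalgebra of a dualizable algebra, no edge leads from a kill state of `a` to `dom a`. -/
theorem mul_mul_letter_eq_zero (he : Function.Injective e) (hN : IsDualizable N)
    {q : AutomaticAlgebra δ} {a : S} (hq : q * letter a = 0) (b : S) :
    q * letter b * letter a = 0 := by
  by_contra hr
  have hrb : ∀ w, mulWord (q * letter b) w ≠ 0 → mulWord (q * letter b) w * letter b ≠ 0 :=
    fun w => mulWord_mul_letter_ne_zero he hN w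
  -- If `a` kills no `q b bᵏ`, then `q b` is immortal: after its first use `a` stays harmless, being
  -- read from its own range. Otherwise the last good `k` before a failure gives a state `s` with `s
  -- a` immortal and `s b a = 0`.
  by_cases H : ∀ k, mulWord (q * letter b) (List.replicate k b) * letter a ≠ 0
  · refine not_isDualizable_of_immortal he (c := b) (d := a) 0 ?_ hq hN
    intro w
    induction w using List.reverseRecOn with
    | nil => exact fun _ h => hr (by rw [mulWord_nil] at h; rw [h, AutomaticAlgebra.zero_mul])
    | append_singleton w x ih =>
      intro hw
      rw [List.forall_mem_append, List.forall_mem_singleton] at hw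
      have hw0 := ih hw.1
      rw [mulWord_concat]
      rcases hw.2 with rfl | rfl
      · exact hrb w hw0
      · by_cases hx : x ∈ w
        · obtain ⟨s, t, rfl⟩ := List.append_of_mem hx
          rw [mulWord_append, mulWord_cons] at hw0 ⊢
          exact mulWord_mul_letter_ne_zero he hN t hw0
        · rw [List.eq_replicate_of_mem fun y hy => (hw.1 y hy).resolve_right
            fun h => hx (h ▸ hy)]
          exact H _
  · push Not at H
    obtain ⟨k, hk, hk'⟩ : ∃ k, mulWord (q * letter b) (List.replicate k b) * letter a ≠ 0 ∧
        mulWord (q * letter b) (List.replicate (k + 1) b) * letter a = 0 := by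
      by_contra! h
      obtain ⟨k, hk⟩ := H
      exact Nat.rec (motive := fun k =>
        mulWord (q * letter b) (List.replicate k b) * letter a ≠ 0) hr (fun k => h k) k hk
    rw [List.replicate_succ', mulWord_concat] at hk'
    refine not_isDualizable_of_immortal he
      (q := mulWord (q * letter b) (List.replicate k b)) (c := a) (d := b) 1 ?_ hk' hN
    intro w
    induction w using List.reverseRecOn with
    | nil => exact fun _ => hk
    | append_singleton w x ih =>
      intro hw
      rw [List.forall_mem_append, List.forall_mem_singleton] at hw
      have hw0 := ih hw.1
      rw [mulWord_concat]
      rcases hw.2 with rfl | rfl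
      · exact mulWord_mul_letter_ne_zero he hN w hw0
      · rw [← mulWord_cons, ← mulWord_append] at hw0 ⊢
        exact hrb _ hw0

end AutomaticAlgebra

/-! ### The two conditions -/

open AutomaticAlgebra in
theorem corollary2p7 {Q : Type u} {S : Type v} [Finite Q] [Finite S] (δ : Q → S → Option Q)
    (h : ∃ a : S,
      (∃ q ∈ AutomaticAlgebra.killStates δ a, ∃ w : List S,
        AutomaticAlgebra.mulWord q w ∈ AutomaticAlgebra.dom δ a) ∨
      (∃ q ∈ AutomaticAlgebra.ran δ a, ∃ w : List S,
        AutomaticAlgebra.mulWord q w ∈ AutomaticAlgebra.killStates δ a)) :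
    InherentlyNonDualizable (AutomaticAlgebra δ) := by
  intro N _ _ e he hN
  obtain ⟨a, ⟨q, hq, w, hw⟩ | ⟨_, ⟨q, -, rfl⟩, w, hw⟩⟩ := h
  · have hq' : q * letter a = 0 := not_not.1 fun h => hq.2 ⟨hq.1, h⟩
    clear hq
    -- Being killed by `a` propagates along each edge of the path.
    induction w generalizing q with
    | nil => exact hw.2 hq'
    | cons b w ih => exact ih (q * letter b) hw (mul_mul_letter_eq_zero he hN hq' b)
  · refine mulWord_mul_letter_ne_zero he hN w (mem_states_iff.1 hw.1).2 ?_
    exact not_not.1 fun h => hw.2 ⟨hw.1, h⟩
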